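/- Let $e=(1,\dots,1)^T\in\mathbb{R}^n$, $E=\operatorname{span}\{e\}$, and let $\|\cdot\|$ be the Euclidean norm. A sequence $(P(k))_{k\in\mathbb{N}}$ of row-stochastic $n\times n$ matrices is called strongly ergodic if its left products $\Phi(k)=P(k-1)\cdots P(0)$ converge as $k\to\infty$ and the difference of any two rows of $\Phi(k)$ tends to $0$. Let $\mathcal{P}\subset\mathbb{R}^{n\times n}$ be a compact set of row-stochastic matrices that is uniformly ergodic, i.e. every sequence in $\mathcal{P}^{\mathbb{N}}$ is strongly ergodic. Let $G:\mathbb{R}^n\to\mathbb{R}$ be differentiable, put $h(y)=y+G(ye)$ for $y\in\mathbb{R}$, and suppose that (i) there are $\varepsilon>0$ and $L>0$ such that $|G(x)-G(z)|\le L\|x-z\|$ for all $x,z\in\mathbb{R}^n$ with $\operatorname{dist}(x,E)\le\varepsilon$ and $\operatorname{dist}(z,E)\le\varepsilon$; (ii) there are $\beta,\gamma>0$ such that $|h(y)|\le|y|-\gamma$ whenever $|y|\ge\beta$. Let $y^*$ be a fixed point of the one-dimensional system $y(k+1)=h(y(k))$ which is globally asymptotically stable and (locally) exponentially stable. Then $y^*e$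 is globally uniformly exponentially stable for the switched system $$x(k+1)=P(k)x(k)+G(x(k))e,\qquad P(k)\in\mathcal{P},$$ under arbitrary switching. That is, $y^*e$ is a fixed point of $x\mapsto Px+G(x)e$ for every $P\in\mathcal{P}$, and there is $r\in(0,1)$ such that for every $R>0$ there is $M\ge1$ with the following property: for every switching sequence $(P(k))_{k\in\mathbb{N}}\in\mathcal{P}^{\mathbb{N}}$, every initial time $k_0\in\mathbb{N}$ and every solution with $\|x(k_0)-y^*e\|\le R$, $$\|x(k)-y^*e\|\le M\,r^{\,k-k_0}\,\|x(k_0)-y^*e\|\qquad\text{for all }k\ge k_0 .$$ -/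

import Mathlib

open Set Filter Topology

namespace ConsensusFeedback

noncomputable section

/-- The vector of ones in Euclidean `n`-space. -/
def ones (n : ℕ) : EuclideanSpace ℝ (Fin n) := WithLp.toLp 2 (fun _ => (1 : ℝ))

/-- The consensus space, the span of the vector of ones. -/
def consensusSpace (n : ℕ) : Submodule ℝ (EuclideanSpace ℝ (Fin n)) :=
  Submodule.span ℝ {ones n}

/-- Left products: `leftProd P k = P (k-1) * ⋯ * P 0`, with `leftProd P 0 = 1`. -/
def leftProd {n : ℕ} (P : ℕ → Matrix (Fin n) (Fin n) ℝ) : ℕ → Matrix (Fin n) (Fin n) ℝ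
  | 0 => 1
  | k + 1 => P k * leftProd P k

/-- Weak ergodicity: the difference of any two rows of the left products tends to zero. -/
def WeaklyErgodic {n : ℕ} (P : ℕ → Matrix (Fin n) (Fin n) ℝ) : Prop :=
  ∀ i j : Fin n, Tendsto (fun k => leftProd P k j - leftProd P k i) atTop (𝓝 0)

/-- Strong ergodicity: weak ergodicity, and the left products converge. -/
def StronglyErgodic {n : ℕ} (P : ℕ → Matrix (Fin n) (Fin n) ℝ) : Prop :=
  WeaklyErgodic P ∧ ∃ Φ : Matrix (Fin n) (Fin n) ℝ, Tendsto (leftProd P) atTop (𝓝 Φ)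

/-- A set of matrices is uniformly ergodic if all sequences in it are strongly ergodic
(used for compact sets of row stochastic matrices). -/
def UniformlyErgodic {n : ℕ} (S : Set (Matrix (Fin n) (Fin n) ℝ)) : Prop :=
  ∀ P : ℕ → Matrix (Fin n) (Fin n) ℝ, (∀ k, P k ∈ S) → StronglyErgodic P

/-- The map `h y = y + G (y e)` of the one-dimensional system. -/
def scalarMap {n : ℕ} (G : EuclideanSpace ℝ (Fin n) → ℝ) (y : ℝ) : ℝ := y + G (y • ones n)

/-- The right-hand side `x ↦ P x + G(x) e` of the consensus system under feedback. -/
def feedbackMap {n : ℕ} (G : EuclideanSpace ℝ (Fin n) → ℝ) (P : Matrix (Fin n) (Fin n) ℝ)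
    (x : EuclideanSpace ℝ (Fin n)) : EuclideanSpace ℝ (Fin n) :=
  WithLp.toLp 2 (P.mulVec x.ofLp) + G x • ones n

/-- Condition (i): `G` is Lipschitz on a closed tube of positive radius around the consensus
space. -/
def LipschitzNearConsensus {n : ℕ} (G : EuclideanSpace ℝ (Fin n) → ℝ) : Prop :=
  ∃ ε > 0, ∃ L > 0, ∀ x z : EuclideanSpace ℝ (Fin n),
    Metric.infDist x (consensusSpace n : Set (EuclideanSpace ℝ (Fin n))) ≤ ε →
    Metric.infDist z (consensusSpace n : Set (EuclideanSpace ℝ (Fin n))) ≤ ε →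
    |G x - G z| ≤ L * ‖x - z‖

/-- Condition (ii): `|h y| ≤ |y| - γ` for all `y` with `|y| ≥ β`. -/
def DecreasingAtInfinity (h : ℝ → ℝ) : Prop :=
  ∃ β > 0, ∃ γ > 0, ∀ y : ℝ, β ≤ |y| → |h y| ≤ |y| - γ

/-- `p` is a globally asymptotically stable fixed point of `y(k+1) = h (y(k))`. -/
def GloballyAsymptoticallyStable (h : ℝ → ℝ) (p : ℝ) : Prop :=
  h p = p ∧
  (∀ ε > 0, ∃ δ > 0, ∀ y : ℝ, |y - p| < δ → ∀ k : ℕ, |h^[k] y - p| < ε) ∧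
  ∀ y : ℝ, Tendsto (fun k : ℕ => h^[k] y) atTop (𝓝 p)

/-- `p` is a (locally) exponentially stable fixed point of `y(k+1) = h (y(k))`. -/
def LocallyExponentiallyStable (h : ℝ → ℝ) (p : ℝ) : Prop :=
  h p = p ∧
  ∃ δ > 0, ∃ M ≥ 1, ∃ r : ℝ, 0 < r ∧ r < 1 ∧
    ∀ y : ℝ, |y - p| < δ → ∀ k : ℕ, |h^[k] y - p| ≤ M * r ^ k * |y - p|

/-- Global uniform exponential stability of `p` for the switched system
`x(k+1) = F (s k) (x k)` under arbitrary switching `s : ℕ → σ`, `s k ∈ S`: there is one decay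
rate `r < 1`, and for every bound `R` on the initial deviation one constant `M`, valid for all
switching sequences and all initial times `k₀`. -/
def GloballyUniformlyExponentiallyStable {σ E : Type*} [NormedAddCommGroup E]
    (F : σ → E → E) (S : Set σ) (p : E) : Prop :=
  (∀ s ∈ S, F s p = p) ∧
  ∃ r : ℝ, 0 < r ∧ r < 1 ∧ ∀ R > 0, ∃ M ≥ 1,
    ∀ s : ℕ → σ, (∀ k, s k ∈ S) → ∀ (k₀ : ℕ) (x : ℕ → E),
      (∀ k, k₀ ≤ k → x (k + 1) = F (s k) (x k)) → ‖x k₀ - p‖ ≤ R →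
      ∀ k, k₀ ≤ k → ‖x k - p‖ ≤ M * r ^ (k - k₀) * ‖x k₀ - p‖

end

end ConsensusFeedback

namespace ConsensusFeedback

/-! The feedback adds a multiple of `ones n`, so coordinate differences evolve under the stochastic
products alone. Ergodicity sends the spread to 0. As the space of switching sequences is compact
(Tychonoff), one time by which it halves serves all of them (`exists_spread_le_half`).

In the tube of (i), each coordinate follows the scalar map `h` up to an error of the order of the
spread (`exists_abs_sub_iterate_le`). Near `p`, exponential stability of `h` and halving of the
spread therefore make `|x i - p| + K * spread x` contract over blocks of fixed length
(`exists_block_contraction`).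

Globally, coordinate `i` is eventually a vanishing perturbation of `h`: (ii) bounds it, and a limit
point transported by `h` shows that it comes close to `p` (`exists_near`). Compactness makes the
entrance time uniform on balls (`exists_uniform_time`); until then the deviation grows at most by a
constant factor (`exists_norm_solution_sub_le`). -/

/-- The largest difference between two coordinates of a vector. -/
noncomputable def spread {n : ℕ} (x : EuclideanSpace ℝ (Fin n)) : ℝ :=
  ‖fun ij : Fin n × Fin n => x ij.1 - x ij.2‖

/-! ### Spread, norm and distance to consensus -/

section Spread

variable {n : ℕ}

theorem ones_apply (i : Fin n) : ones n i = 1 := rfl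

theorem spread_nonneg (x : EuclideanSpace ℝ (Fin n)) : 0 ≤ spread x := norm_nonneg _

theorem abs_sub_le_spread (x : EuclideanSpace ℝ (Fin n)) (i j : Fin n) :
    |x i - x j| ≤ spread x :=
  norm_le_pi_norm (fun ij : Fin n × Fin n => x ij.1 - x ij.2) (i, j)

theorem spread_le {x : EuclideanSpace ℝ (Fin n)} {d : ℝ} (hd : 0 ≤ d)
    (h : ∀ i j, |x i - x j| ≤ d) : spread x ≤ d :=
  (pi_norm_le_iff_of_nonneg hd).2 fun ij => h ij.1 ij.2

theorem continuous_spread : Continuous (spread (n := n)) := by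
  unfold spread
  fun_prop

theorem norm_le_card_mul {x : EuclideanSpace ℝ (Fin n)} {d : ℝ} (h : ∀ i, |x i| ≤ d) :
    ‖x‖ ≤ n * d := by
  have hx : x = ∑ i, x i • EuclideanSpace.single i (1 : ℝ) := by
    ext j
    simp [Pi.single_apply]
  rw [hx]
  calc ‖∑ i, x i • EuclideanSpace.single i (1 : ℝ)‖
      ≤ ∑ i : Fin n, ‖x i • EuclideanSpace.single i (1 : ℝ)‖ := norm_sum_le _ _
    _ ≤ ∑ _i : Fin n, d := Finset.sum_le_sum fun i _ => by
        simpa [norm_smul] using h i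
    _ = n * d := by simp

theorem abs_apply_le_norm (x : EuclideanSpace ℝ (Fin n)) (i : Fin n) : |x i| ≤ ‖x‖ :=
  PiLp.norm_apply_le x i

theorem norm_ones_le : ‖ones n‖ ≤ n := by
  simpa using norm_le_card_mul (x := ones n) (d := 1) fun i => by simp [ones_apply]

theorem norm_sub_smul_ones_le (x : EuclideanSpace ℝ (Fin n)) (i : Fin n) :
    ‖x - x i • ones n‖ ≤ n * spread x :=
  norm_le_card_mul fun j => by simpa [ones_apply] using abs_sub_le_spread x j i

theorem spread_le_two_mul_norm_sub (x : EuclideanSpace ℝ (Fin n)) (a : ℝ) :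
    spread x ≤ 2 * ‖x - a • ones n‖ := by
  refine spread_le (by positivity) fun i j => ?_
  have hi := abs_apply_le_norm (x - a • ones n) i
  have hj := abs_apply_le_norm (x - a • ones n) j
  simp only [PiLp.sub_apply, PiLp.smul_apply, ones_apply, smul_eq_mul, mul_one] at hi hj
  rw [abs_le] at *
  constructor <;> linarith [hi.1, hi.2, hj.1, hj.2]

theorem abs_apply_sub_le_norm (x : EuclideanSpace ℝ (Fin n)) (a : ℝ) (i : Fin n) :
    |x i - a| ≤ ‖x - a • ones n‖ := by
  simpa [ones_apply] using abs_apply_le_norm (x - a • ones n) i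

theorem norm_sub_smul_ones_le_add (x : EuclideanSpace ℝ (Fin n)) (a : ℝ) (i : Fin n) :
    ‖x - a • ones n‖ ≤ n * (|x i - a| + spread x) :=
  norm_le_card_mul fun j => by
    simp only [PiLp.sub_apply, PiLp.smul_apply, ones_apply, smul_eq_mul, mul_one]
    calc |x j - a| ≤ |x j - x i| + |x i - a| := abs_sub_le _ _ _
      _ ≤ |x i - a| + spread x := by linarith [abs_sub_le_spread x j i]

theorem infDist_consensusSpace_le_norm_sub (x : EuclideanSpace ℝ (Fin n)) (a : ℝ) :
    Metric.infDist x (consensusSpace n : Set (EuclideanSpace ℝ (Fin n))) ≤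
      ‖x - a • ones n‖ := by
  rw [← dist_eq_norm]
  exact Metric.infDist_le_dist_of_mem
    ((consensusSpace n).smul_mem a (Submodule.mem_span_singleton_self _))

theorem infDist_smul_ones (a : ℝ) :
    Metric.infDist (a • ones n) (consensusSpace n : Set (EuclideanSpace ℝ (Fin n))) = 0 :=
  Metric.infDist_zero_of_mem ((consensusSpace n).smul_mem a (Submodule.mem_span_singleton_self _))

end Spread

/-! ### Averaging by stochastic matrices -/

section Stochastic

variable {n : ℕ} {P : Matrix (Fin n) (Fin n) ℝ}

theorem sum_row_eq_one (hP : P ∈ Matrix.rowStochastic ℝ (Fin n)) (i : Fin n) :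
    ∑ j, P i j = 1 := Matrix.sum_row_of_mem_rowStochastic hP i

theorem mulVec_sub_const (hP : P ∈ Matrix.rowStochastic ℝ (Fin n)) (v : Fin n → ℝ) (a : ℝ)
    (i : Fin n) : P.mulVec v i - a = ∑ j, P i j * (v j - a) := by
  simp [mul_sub, Finset.sum_sub_distrib, ← Finset.sum_mul, sum_row_eq_one hP i, Matrix.mulVec,
    dotProduct]

theorem abs_mulVec_sub_le (hP : P ∈ Matrix.rowStochastic ℝ (Fin n)) {v : Fin n → ℝ} {a d : ℝ}
    (h : ∀ j, |v j - a| ≤ d) (i : Fin n) : |P.mulVec v i - a| ≤ d := by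
  rw [mulVec_sub_const hP]
  calc |∑ j, P i j * (v j - a)| ≤ ∑ j, |P i j * (v j - a)| := Finset.abs_sum_le_sum_abs _ _
    _ ≤ ∑ j, P i j * d := Finset.sum_le_sum fun j _ => by
        rw [abs_mul, abs_of_nonneg (Matrix.nonneg_of_mem_rowStochastic hP)]
        exact mul_le_mul_of_nonneg_left (h j) (Matrix.nonneg_of_mem_rowStochastic hP)
    _ = d := by rw [← Finset.sum_mul, sum_row_eq_one hP, one_mul]

theorem abs_mulVec_sub_apply_le (hP : P ∈ Matrix.rowStochastic ℝ (Fin n))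
    (x : EuclideanSpace ℝ (Fin n)) (i j : Fin n) : |P.mulVec x.ofLp i - x j| ≤ spread x :=
  abs_mulVec_sub_le hP (fun k => abs_sub_le_spread x k j) i

theorem spread_feedbackMap_le (hP : P ∈ Matrix.rowStochastic ℝ (Fin n))
    (G : EuclideanSpace ℝ (Fin n) → ℝ) (x : EuclideanSpace ℝ (Fin n)) :
    spread (feedbackMap G P x) ≤ spread x := by
  refine spread_le (spread_nonneg x) fun i j => ?_
  simp only [feedbackMap, PiLp.add_apply, PiLp.smul_apply, ones_apply, add_sub_add_right_eq_sub]
  refine abs_mulVec_sub_le hP (fun k => ?_) i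
  rw [abs_sub_comm]
  exact abs_mulVec_sub_apply_le hP x j k

theorem leftProd_mem_rowStochastic {P : ℕ → Matrix (Fin n) (Fin n) ℝ}
    (hP : ∀ k, P k ∈ Matrix.rowStochastic ℝ (Fin n)) (k : ℕ) :
    leftProd P k ∈ Matrix.rowStochastic ℝ (Fin n) := by
  induction k with
  | zero => exact one_mem _
  | succ k ih => exact mul_mem (hP k) ih

theorem continuous_leftProd (k : ℕ) :
    Continuous fun P : ℕ → Matrix (Fin n) (Fin n) ℝ => leftProd P k := by
  induction k with
  | zero => exact continuous_const
  | succ k ih => exact (continuous_apply k).mul ih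

end Stochastic

/-- `x` is a solution of the consensus system under feedback with switching sequence `P`. -/
def IsSolution {n : ℕ} (G : EuclideanSpace ℝ (Fin n) → ℝ) (P : ℕ → Matrix (Fin n) (Fin n) ℝ)
    (x : ℕ → EuclideanSpace ℝ (Fin n)) : Prop :=
  ∀ k, x (k + 1) = feedbackMap G (P k) (x k)

/-! ### Coordinate differences along solutions -/

section Solutions

variable {n : ℕ} {G : EuclideanSpace ℝ (Fin n) → ℝ} {P : ℕ → Matrix (Fin n) (Fin n) ℝ}
  {x : ℕ → EuclideanSpace ℝ (Fin n)}

theorem IsSolution.shift (hx : IsSolution G P x) (m : ℕ) :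
    IsSolution G (fun k => P (m + k)) fun k => x (m + k) := fun k => hx (m + k)

theorem IsSolution.spread_antitone (hP : ∀ k, P k ∈ Matrix.rowStochastic ℝ (Fin n))
    (hx : IsSolution G P x) : Antitone fun k => spread (x k) :=
  antitone_nat_of_succ_le fun k => by
    rw [hx k]
    exact spread_feedbackMap_le (hP k) G (x k)

/-- Stochastic matrices fix constant vectors, so all feedback terms accumulate in one scalar `a`. -/
theorem IsSolution.eq_leftProd_add (hP : ∀ k, P k ∈ Matrix.rowStochastic ℝ (Fin n))
    (hx : IsSolution G P x) (k : ℕ) :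
    ∃ a : ℝ, ∀ i, x k i = (leftProd P k).mulVec (x 0).ofLp i + a := by
  induction k with
  | zero => exact ⟨0, fun i => by simp [leftProd]⟩
  | succ k ih =>
    obtain ⟨a, ha⟩ := ih
    refine ⟨a + G (x k), fun i => ?_⟩
    have hxk : (x k).ofLp = (leftProd P k).mulVec (x 0).ofLp + fun _ => a := funext ha
    have hc : (P k).mulVec (fun _ => a) i = a := by
      have := mulVec_sub_const (hP k) (fun _ => a) a i
      simpa [sub_eq_zero] using this
    rw [hx k]
    simp only [feedbackMap, PiLp.add_apply, PiLp.smul_apply, ones_apply, smul_eq_mul, mul_one,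
      leftProd, ← Matrix.mulVec_mulVec]
    nth_rewrite 1 [hxk]
    rw [Matrix.mulVec_add, Pi.add_apply, hc, add_assoc]

/-- Rows of the product sum to 1, so recentring at `x 0 l` is free; it makes every factor at most
the initial spread. -/
theorem IsSolution.apply_sub_apply (hP : ∀ k, P k ∈ Matrix.rowStochastic ℝ (Fin n))
    (hx : IsSolution G P x) (k : ℕ) (i j l : Fin n) :
    x k i - x k j = ∑ m, (leftProd P k i - leftProd P k j) m * (x 0 m - x 0 l) := by
  obtain ⟨a, ha⟩ := hx.eq_leftProd_add hP k
  have hi := mulVec_sub_const (leftProd_mem_rowStochastic hP k) (x 0).ofLp (x 0 l) i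
  have hj := mulVec_sub_const (leftProd_mem_rowStochastic hP k) (x 0).ofLp (x 0 l) j
  simp only [Pi.sub_apply, sub_mul, Finset.sum_sub_distrib]
  rw [← hi, ← hj, ha, ha]
  ring

theorem IsSolution.tendsto_spread (hP : ∀ k, P k ∈ Matrix.rowStochastic ℝ (Fin n))
    (hx : IsSolution G P x) (hw : WeaklyErgodic P) :
    Tendsto (fun k => spread (x k)) atTop (𝓝 0) := by
  have h : Tendsto (fun k (ij : Fin n × Fin n) => x k ij.1 - x k ij.2) atTop (𝓝 0) := by
    refine tendsto_pi_nhds.2 fun ij => ?_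
    simp_rw [hx.apply_sub_apply hP _ ij.1 ij.2 ij.1]
    have : Tendsto (fun k => ∑ m, (leftProd P k ij.1 - leftProd P k ij.2) m *
        (x 0 m - x 0 ij.1)) atTop (𝓝 (∑ m, (0 : Fin n → ℝ) m * (x 0 m - x 0 ij.1))) :=
      tendsto_finsetSum _ fun m _ => ((tendsto_pi_nhds.1 (hw ij.2 ij.1) m).mul_const _)
    simpa using this
  simpa [spread] using h.norm

end Solutions

/-! ### Uniform halving of the spread by compactness -/

/-- A countable open cover of a compact set has a bounded finite subcover. -/
theorem _root_.IsCompact.exists_bound_of_iUnion_nat {α : Type*} [TopologicalSpace α] {K : Set α}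
    (hK : IsCompact K) {U : ℕ → Set α} (hU : ∀ k, IsOpen (U k)) (hKU : ∀ a ∈ K, ∃ k, a ∈ U k) :
    ∃ N, ∀ a ∈ K, ∃ k ≤ N, a ∈ U k := by
  obtain ⟨t, ht⟩ := hK.elim_finite_subcover U hU fun a ha => mem_iUnion.2 (hKU a ha)
  refine ⟨t.sup id, fun a ha => ?_⟩
  obtain ⟨k, hk, hak⟩ := mem_iUnion₂.1 (ht ha)
  exact ⟨k, Finset.le_sup (f := id) hk, hak⟩

theorem isCompact_sequences {α : Type*} [TopologicalSpace α] {S : Set α} (hS : IsCompact S) :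
    IsCompact {P : ℕ → α | ∀ k, P k ∈ S} := by
  simpa [Set.pi] using isCompact_univ_pi (ι := ℕ) fun _ => hS

/-- Products of a fixed length of matrices in a compact uniformly ergodic set halve the spread. -/
theorem exists_spread_le_half {n : ℕ} {S : Set (Matrix (Fin n) (Fin n) ℝ)} (hS : IsCompact S)
    (hstoch : S ⊆ (Matrix.rowStochastic ℝ (Fin n) : Set (Matrix (Fin n) (Fin n) ℝ)))
    (herg : UniformlyErgodic S) (G : EuclideanSpace ℝ (Fin n) → ℝ) :
    ∃ N, ∀ P : ℕ → Matrix (Fin n) (Fin n) ℝ, (∀ k, P k ∈ S) → ∀ x, IsSolution G P x →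
      ∀ k, N ≤ k → spread (x k) ≤ spread (x 0) / 2 := by
  -- The `n` entries of a row difference then sum to less than 1/2 in absolute value; `n + 1` keeps
  -- the bound meaningful for `n = 0`.
  let U : ℕ → Set (ℕ → Matrix (Fin n) (Fin n) ℝ) := fun k =>
    {P | ∀ i j m, |(leftProd P k j - leftProd P k i) m| < 1 / (2 * (n + 1))}
  have hU : ∀ k, IsOpen (U k) := fun k => by
    simp only [U, ofPred_forall]
    refine isOpen_iInter_of_finite fun i => isOpen_iInter_of_finite fun j =>
      isOpen_iInter_of_finite fun m => isOpen_lt ?_ continuous_const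
    have h := continuous_leftProd (n := n) k
    exact (((continuous_apply_apply j m).comp h).sub ((continuous_apply_apply i m).comp h)).abs
  obtain ⟨N, hN⟩ := (isCompact_sequences hS).exists_bound_of_iUnion_nat hU fun P hP => by
    have : ∀ᶠ k in atTop, P ∈ U k := by
      simp only [U, mem_ofPred_eq, eventually_all]
      intro i j m
      have h := (tendsto_pi_nhds.1 ((herg P hP).1 i j) m).abs
      rw [Pi.zero_apply, abs_zero] at h
      exact h.eventually (gt_mem_nhds (by positivity))
    exact this.exists
  refine ⟨N, fun P hP x hx k hk => ?_⟩
  obtain ⟨l, hl, hPl⟩ := hN P hP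
  refine (hx.spread_antitone (fun k => hstoch (hP k)) (hl.trans hk)).trans ?_
  refine spread_le (by linarith [spread_nonneg (x 0)]) fun i j => ?_
  rw [hx.apply_sub_apply (fun k => hstoch (hP k)) l i j i]
  calc _ ≤ ∑ m, |(leftProd P l i - leftProd P l j) m * (x 0 m - x 0 i)| :=
        Finset.abs_sum_le_sum_abs _ _
    _ ≤ ∑ _m : Fin n, 1 / (2 * ((n : ℝ) + 1)) * spread (x 0) := Finset.sum_le_sum fun m _ => by
        rw [abs_mul]
        exact mul_le_mul (hPl j i m).le (abs_sub_le_spread _ _ _) (abs_nonneg _) (by positivity)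
    _ = (n / (n + 1)) * (spread (x 0) / 2) := by
        simp only [Finset.sum_const, Finset.card_univ, Fintype.card_fin, nsmul_eq_mul]
        field_simp
    _ ≤ 1 * (spread (x 0) / 2) := by
        refine mul_le_mul_of_nonneg_right ?_ (by linarith [spread_nonneg (x 0)])
        rw [div_le_one (by positivity)]
        linarith
    _ = _ := one_mul _

/-! ### Vanishing perturbations of the scalar system -/

section ScalarPerturbation

variable {h : ℝ → ℝ}

/-- Vanishing perturbations of a scalar system that decreases at infinity have bounded
solutions. -/
theorem DecreasingAtInfinity.exists_bound (hd : DecreasingAtInfinity h) (hc : Continuous h)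
    {y δ : ℕ → ℝ} (hy : ∀ k, y (k + 1) = h (y k) + δ k) (hδ : Tendsto δ atTop (𝓝 0)) :
    ∃ B, ∀ᶠ k in atTop, |y k| ≤ B := by
  obtain ⟨β, -, γ, hγ, hβγ⟩ := hd
  obtain ⟨C, hC⟩ := (isCompact_Icc (a := -β) (b := β)).exists_bound_of_continuousOn hc.continuousOn
  have hδ' : ∀ᶠ k in atTop, |δ k| ≤ γ := by
    have := hδ.abs
    rw [abs_zero] at this
    exact this.eventually (ge_mem_nhds hγ)
  obtain ⟨k₁, hk₁⟩ := eventually_atTop.1 hδ'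
  -- Once `|δ k| ≤ γ`, the decrease outside `[-β, β]` absorbs the perturbation; inside, `|h| ≤ C`.
  refine ⟨max |y k₁| (C + γ), eventually_atTop.2 ⟨k₁, fun k hk => ?_⟩⟩
  induction k, hk using Nat.le_induction with
  | base => exact le_max_left _ _
  | succ k hk ih =>
    rw [hy]
    have h1 := abs_add_le (h (y k)) (δ k)
    have h2 := hk₁ k hk
    rcases le_total β |y k| with hb | hb
    · exact le_trans (by linarith [hβγ _ hb]) ih
    · refine le_trans ?_ (le_max_right _ _)
      have := hC (y k) (abs_le.1 hb)
      rw [Real.norm_eq_abs] at this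
      linarith

/-- Only `m` perturbations intervene, all vanishing, so by continuity limit points move along the
unperturbed orbit. -/
theorem tendsto_comp_add_iterate (hc : Continuous h) {y δ : ℕ → ℝ}
    (hy : ∀ k, y (k + 1) = h (y k) + δ k) (hδ : Tendsto δ atTop (𝓝 0)) {φ : ℕ → ℕ}
    (hφ : Tendsto φ atTop atTop) {z : ℝ} (hz : Tendsto (y ∘ φ) atTop (𝓝 z)) (m : ℕ) :
    Tendsto (fun j => y (φ j + m)) atTop (𝓝 (h^[m] z)) := by
  induction m with
  | zero => exact hz
  | succ m ih =>
    simp only [← add_assoc, hy, Function.iterate_succ_apply']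
    have h2 : Tendsto (fun j => δ (φ j + m)) atTop (𝓝 0) :=
      hδ.comp ((tendsto_add_atTop_nat m).comp hφ)
    simpa using ((hc.tendsto _).comp ih).add h2

/-- Vanishing perturbations of a scalar system that decreases at infinity visit every
neighbourhood of a globally attractive point, at arbitrarily late times. -/
theorem DecreasingAtInfinity.frequently_lt (hd : DecreasingAtInfinity h) (hc : Continuous h)
    {p : ℝ} (hp : ∀ y, Tendsto (fun k : ℕ => h^[k] y) atTop (𝓝 p)) {y δ : ℕ → ℝ}
    (hy : ∀ k, y (k + 1) = h (y k) + δ k) (hδ : Tendsto δ atTop (𝓝 0)) {η : ℝ} (hη : 0 < η) :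
    ∃ᶠ k in atTop, |y k - p| < η := by
  obtain ⟨B, hB⟩ := hd.exists_bound hc hy hδ
  obtain ⟨z, -, φ, hφ, hz⟩ := (isCompact_Icc (a := -B) (b := B)).tendsto_subseq'
    (hB.mono fun k hk => (abs_le.1 hk : y k ∈ Icc (-B) B)).frequently
  obtain ⟨m, hm⟩ := ((hp z).eventually (Metric.ball_mem_nhds p hη)).exists
  have hlim := tendsto_comp_add_iterate hc hy hδ hφ.tendsto_atTop hz m
  have hev : ∀ᶠ j in atTop, |y (φ j + m) - p| < η :=
    hlim.eventually (Metric.isOpen_ball.mem_nhds hm)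
  exact ((tendsto_add_atTop_nat m).comp hφ.tendsto_atTop).frequently hev.frequently

end ScalarPerturbation

/-! ### Comparison with the scalar map near consensus -/

section Tube

variable {n : ℕ} {G : EuclideanSpace ℝ (Fin n) → ℝ} {ε L : ℝ}

theorem abs_scalarMap_sub_le (hε : 0 < ε) (hL : 0 < L)
    (hGL : ∀ x z : EuclideanSpace ℝ (Fin n),
      Metric.infDist x (consensusSpace n : Set (EuclideanSpace ℝ (Fin n))) ≤ ε →
      Metric.infDist z (consensusSpace n : Set (EuclideanSpace ℝ (Fin n))) ≤ ε →
      |G x - G z| ≤ L * ‖x - z‖) (a b : ℝ) :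
    |scalarMap G a - scalarMap G b| ≤ (1 + L * n) * |a - b| := by
  have h1 := hGL (a • ones n) (b • ones n) (by rw [infDist_smul_ones]; exact hε.le)
    (by rw [infDist_smul_ones]; exact hε.le)
  rw [← sub_smul, norm_smul, Real.norm_eq_abs] at h1
  have h2 : L * (|a - b| * ‖ones n‖) ≤ L * (|a - b| * n) := by
    have := norm_ones_le (n := n)
    gcongr
  have h3 := abs_add_le (a - b) (G (a • ones n) - G (b • ones n))
  rw [show scalarMap G a - scalarMap G b = a - b + (G (a • ones n) - G (b • ones n)) by
    simp only [scalarMap]; ring]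
  nlinarith

/-- Averaging moves a coordinate by at most the spread; replacing `x` by `x i • ones n` inside `G`
costs at most `L * n` times the spread. -/
theorem abs_feedbackMap_apply_sub_le (hε : 0 < ε) (hL : 0 < L)
    (hGL : ∀ x z : EuclideanSpace ℝ (Fin n),
      Metric.infDist x (consensusSpace n : Set (EuclideanSpace ℝ (Fin n))) ≤ ε →
      Metric.infDist z (consensusSpace n : Set (EuclideanSpace ℝ (Fin n))) ≤ ε →
      |G x - G z| ≤ L * ‖x - z‖) {P : Matrix (Fin n) (Fin n) ℝ}
    (hP : P ∈ Matrix.rowStochastic ℝ (Fin n)) {x : EuclideanSpace ℝ (Fin n)}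
    (hx : n * spread x ≤ ε) (i : Fin n) :
    |feedbackMap G P x i - scalarMap G (x i)| ≤ (1 + L * n) * spread x := by
  have h0 := norm_sub_smul_ones_le x i
  have h1 := hGL x (x i • ones n)
    ((infDist_consensusSpace_le_norm_sub x (x i)).trans (h0.trans hx))
    (by rw [infDist_smul_ones]; exact hε.le)
  have h2 := abs_mulVec_sub_apply_le hP x i i
  have h3 := abs_add_le (P.mulVec x.ofLp i - x i) (G x - G (x i • ones n))
  rw [show feedbackMap G P x i - scalarMap G (x i) =
    P.mulVec x.ofLp i - x i + (G x - G (x i • ones n)) by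
      simp only [scalarMap, feedbackMap, PiLp.add_apply, PiLp.smul_apply, ones_apply, smul_eq_mul,
        mul_one]
      ring]
  have h4 := mul_le_mul_of_nonneg_left h0 hL.le
  linarith

/-- Each step adds a one-step error and amplifies the old one by the Lipschitz constant of `h`;
monotonicity of the spread keeps the solution in the tube. -/
theorem exists_abs_sub_iterate_le (hε : 0 < ε) (hL : 0 < L)
    (hGL : ∀ x z : EuclideanSpace ℝ (Fin n),
      Metric.infDist x (consensusSpace n : Set (EuclideanSpace ℝ (Fin n))) ≤ ε →
      Metric.infDist z (consensusSpace n : Set (EuclideanSpace ℝ (Fin n))) ≤ ε →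
      |G x - G z| ≤ L * ‖x - z‖) (k : ℕ) :
    ∃ C ≥ 0, ∀ P : ℕ → Matrix (Fin n) (Fin n) ℝ,
      (∀ k, P k ∈ Matrix.rowStochastic ℝ (Fin n)) → ∀ x, IsSolution G P x →
        n * spread (x 0) ≤ ε → ∀ i,
          |x k i - (scalarMap G)^[k] (x 0 i)| ≤ C * spread (x 0) := by
  induction k with
  | zero => exact ⟨0, le_rfl, fun P hP x hx _ i => by simp⟩
  | succ k ih =>
    obtain ⟨C, hC, h⟩ := ih
    refine ⟨(1 + L * n) + (1 + L * n) * C, by positivity, fun P hP x hx hx0 i => ?_⟩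
    have hanti : spread (x k) ≤ spread (x 0) := hx.spread_antitone hP (Nat.zero_le k)
    have h1 := abs_feedbackMap_apply_sub_le hε hL hGL (hP k) (x := x k)
      ((mul_le_mul_of_nonneg_left hanti n.cast_nonneg).trans hx0) i
    have h2 := abs_scalarMap_sub_le hε hL hGL (x k i) ((scalarMap G)^[k] (x 0 i))
    have h3 := h P hP x hx hx0 i
    have hc : 0 ≤ 1 + L * n := by positivity
    rw [← hx k] at h1
    rw [Function.iterate_succ_apply']
    calc _ ≤ _ := abs_sub_le _ (scalarMap G (x k i)) _
      _ ≤ (1 + L * n) * spread (x 0) + (1 + L * n) * (C * spread (x 0)) :=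
        add_le_add (h1.trans (mul_le_mul_of_nonneg_left hanti hc))
          (h2.trans (mul_le_mul_of_nonneg_left h3 hc))
      _ = _ := by ring

/-- Near a locally exponentially stable point, a weighted sum of the scalar deviation and the
spread contracts over blocks of a fixed length. -/
theorem exists_block_contraction {S : Set (Matrix (Fin n) (Fin n) ℝ)} (hS : IsCompact S)
    (hstoch : S ⊆ (Matrix.rowStochastic ℝ (Fin n) : Set (Matrix (Fin n) (Fin n) ℝ)))
    (herg : UniformlyErgodic S) (hi : LipschitzNearConsensus G) {p : ℝ}
    (hexp : LocallyExponentiallyStable (scalarMap G) p) (i : Fin n) :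
    ∃ N > 0, ∃ K > 0, ∃ ρ > 0, ∀ P : ℕ → Matrix (Fin n) (Fin n) ℝ, (∀ k, P k ∈ S) →
      ∀ x, IsSolution G P x → |x 0 i - p| + K * spread (x 0) < ρ →
        |x N i - p| + K * spread (x N) ≤ 3 / 4 * (|x 0 i - p| + K * spread (x 0)) := by
  obtain ⟨ε, hε, L, hL, hGL⟩ := hi
  obtain ⟨-, δ, hδ, M, hM, r, hr0, hr1, hloc⟩ := hexp
  obtain ⟨N₁, hN₁⟩ := exists_spread_le_half hS hstoch herg G
  have hlim : ∀ᶠ k : ℕ in atTop, M * r ^ k < 1 / 2 := by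
    have := (tendsto_pow_atTop_nhds_zero_of_lt_one hr0.le hr1).const_mul M
    rw [mul_zero] at this
    exact this.eventually (gt_mem_nhds (by norm_num))
  obtain ⟨N, hNM, hNN₁, hN0⟩ :=
    (hlim.and ((eventually_ge_atTop N₁).and (eventually_gt_atTop 0))).exists
  obtain ⟨C, hC, hit⟩ := exists_abs_sub_iterate_le hε hL hGL N
  -- `C + K / 2 ≤ 3 / 4 * K` needs `K ≥ 4 * C`; `K ≥ n` puts the start in the tube, and the 1 makes
  -- `K` positive.
  refine ⟨N, hN0, 4 * C + n + 1, by positivity, min δ ε, lt_min hδ hε, fun P hP x hx hρ => ?_⟩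
  have hD := spread_nonneg (x 0)
  have hn : (0 : ℝ) ≤ n := n.cast_nonneg
  have hy := abs_nonneg (x 0 i - p)
  have hρ1 := hρ.trans_le (min_le_left _ _)
  have hρ2 := hρ.trans_le (min_le_right _ _)
  have hCD := mul_nonneg hC hD
  have hnD := mul_nonneg hn hD
  have h1 := hit P (fun k => hstoch (hP k)) x hx (by nlinarith) i
  have h2 := hN₁ P hP x hx N hNN₁
  have h3 := hloc (x 0 i) (by nlinarith) N
  have h4 := mul_le_mul_of_nonneg_right hNM.le hy
  have h5 := abs_sub_le (x N i) ((scalarMap G)^[N] (x 0 i)) p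
  have h6 : (4 * C + n + 1) * spread (x N) ≤ (4 * C + n + 1) * (spread (x 0) / 2) :=
    mul_le_mul_of_nonneg_left h2 (by positivity)
  nlinarith

/-- Every solution comes arbitrarily close to the equilibrium. -/
theorem exists_near {P : ℕ → Matrix (Fin n) (Fin n) ℝ}
    (hP : ∀ k, P k ∈ Matrix.rowStochastic ℝ (Fin n)) (hw : WeaklyErgodic P)
    (hi : LipschitzNearConsensus G) (hii : DecreasingAtInfinity (scalarMap G))
    (hG : Continuous G) {p : ℝ}
    (hp : ∀ y, Tendsto (fun k : ℕ => (scalarMap G)^[k] y) atTop (𝓝 p))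
    {x : ℕ → EuclideanSpace ℝ (Fin n)} (hx : IsSolution G P x) (i : Fin n) {K ρ : ℝ}
    (hρ : 0 < ρ) : ∃ k, |x k i - p| + K * spread (x k) < ρ := by
  obtain ⟨ε, hε, L, hL, hGL⟩ := hi
  have hs := hx.tendsto_spread hP hw
  have hδ : Tendsto (fun k => x (k + 1) i - scalarMap G (x k i)) atTop (𝓝 0) := by
    have h1 : Tendsto (fun k => n * spread (x k)) atTop (𝓝 0) := by
      simpa using hs.const_mul (n : ℝ)
    have h2 : Tendsto (fun k => (1 + L * n) * spread (x k)) atTop (𝓝 0) := by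
      simpa using hs.const_mul (1 + L * n)
    refine squeeze_zero_norm' ?_ h2
    filter_upwards [h1.eventually (ge_mem_nhds hε)] with k hk
    rw [Real.norm_eq_abs, hx k]
    exact abs_feedbackMap_apply_sub_le hε hL hGL (hP k) hk i
  have hc : Continuous (scalarMap G) := by
    unfold scalarMap
    fun_prop
  have hf := hii.frequently_lt hc hp (y := fun k => x k i) (fun k => by ring) hδ (half_pos hρ)
  have hK : ∀ᶠ k in atTop, K * spread (x k) < ρ / 2 := by
    have := hs.const_mul K
    rw [mul_zero] at this
    exact this.eventually (gt_mem_nhds (half_pos hρ))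
  obtain ⟨k, hk1, hk2⟩ := (hf.and_eventually hK).exists
  exact ⟨k, by linarith⟩

end Tube

/-! ### Growth over finitely many steps -/

section Growth

variable {n : ℕ} {G : EuclideanSpace ℝ (Fin n) → ℝ}

theorem apply_eq_zero_of_fixed {p : ℝ} (hp : scalarMap G p = p) : G (p • ones n) = 0 := by
  simpa [scalarMap] using hp

theorem feedbackMap_fixed {p : ℝ} (hp : scalarMap G p = p) {P : Matrix (Fin n) (Fin n) ℝ}
    (hP : P ∈ Matrix.rowStochastic ℝ (Fin n)) :
    feedbackMap G P (p • ones n) = p • ones n := by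
  ext i
  have h := abs_mulVec_sub_apply_le hP (p • ones n) i i
  have h0 : spread (p • ones n) = 0 :=
    le_antisymm (by simpa using spread_le_two_mul_norm_sub (p • ones n) p) (spread_nonneg _)
  rw [h0, abs_nonpos_iff, sub_eq_zero] at h
  simpa [feedbackMap, apply_eq_zero_of_fixed hp] using h

/-- `G` vanishes at the equilibrium. Within distance `ε` the Lipschitz bound applies; farther out, a
bound `B` on the ball becomes linear at the cost of `1 / ε`. -/
theorem exists_norm_feedbackMap_sub_le (hG : Continuous G) (hi : LipschitzNearConsensus G) {p : ℝ}
    (hp : scalarMap G p = p) (R : ℝ) :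
    ∃ C ≥ 1, ∀ P ∈ Matrix.rowStochastic ℝ (Fin n), ∀ x, ‖x - p • ones n‖ ≤ R →
      ‖feedbackMap G P x - p • ones n‖ ≤ C * ‖x - p • ones n‖ := by
  obtain ⟨ε, hε, L, hL, hGL⟩ := hi
  obtain ⟨B, hB⟩ := (isCompact_closedBall (p • ones n) R).exists_bound_of_continuousOn
    hG.continuousOn
  have hGx : ∀ x, ‖x - p • ones n‖ ≤ R → |G x| ≤ (L + |B| / ε) * ‖x - p • ones n‖ := by
    intro x hx
    have hx0 := norm_nonneg (x - p • ones n)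
    have hBε : 0 ≤ |B| / ε := by positivity
    rw [add_mul]
    rcases le_total ‖x - p • ones n‖ ε with h | h
    · have := hGL x (p • ones n) ((infDist_consensusSpace_le_norm_sub x p).trans h)
        (by rw [infDist_smul_ones]; exact hε.le)
      rw [apply_eq_zero_of_fixed hp, sub_zero] at this
      exact this.trans (le_add_of_nonneg_right (mul_nonneg hBε hx0))
    · have h1 : |G x| ≤ |B| :=
        (hB x (mem_closedBall_iff_norm.2 hx)).trans (le_abs_self B)
      have h2 : |B| ≤ |B| / ε * ‖x - p • ones n‖ := by
        rw [div_mul_eq_mul_div, le_div_iff₀ hε]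
        exact mul_le_mul_of_nonneg_left h (abs_nonneg B)
      exact (h1.trans h2).trans (le_add_of_nonneg_left (mul_nonneg hL.le hx0))
  refine ⟨1 + n * (1 + (L + |B| / ε)), ?_, fun P hP x hx => ?_⟩
  · have : 0 ≤ n * (1 + (L + |B| / ε)) := by positivity
    linarith
  · have hx0 := norm_nonneg (x - p • ones n)
    have key : ‖feedbackMap G P x - p • ones n‖ ≤
        n * (‖x - p • ones n‖ + (L + |B| / ε) * ‖x - p • ones n‖) :=
      norm_le_card_mul fun i => by
        have h1 := abs_mulVec_sub_le hP (fun j => abs_apply_sub_le_norm x p j) i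
        have h2 := abs_add_le (P.mulVec x.ofLp i - p) (G x)
        simp only [feedbackMap, PiLp.add_apply, PiLp.sub_apply, PiLp.smul_apply, ones_apply,
          smul_eq_mul, mul_one]
        rw [add_sub_right_comm]
        exact h2.trans (add_le_add h1 (hGx x hx))
    calc _ ≤ _ := key
      _ ≤ _ := by nlinarith

theorem exists_norm_solution_sub_le (hG : Continuous G) (hi : LipschitzNearConsensus G) {p : ℝ}
    (hp : scalarMap G p = p) (R : ℝ) (T : ℕ) :
    ∃ C ≥ 1, ∀ P : ℕ → Matrix (Fin n) (Fin n) ℝ,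
      (∀ k, P k ∈ Matrix.rowStochastic ℝ (Fin n)) → ∀ x, IsSolution G P x →
        ‖x 0 - p • ones n‖ ≤ R → ∀ k ≤ T,
          ‖x k - p • ones n‖ ≤ C * ‖x 0 - p • ones n‖ := by
  induction T with
  | zero =>
    refine ⟨1, le_rfl, fun P hP x hx hR k hk => ?_⟩
    rw [Nat.le_zero.1 hk, one_mul]
  | succ T ih =>
    obtain ⟨C, hC, h⟩ := ih
    -- After `T` steps the state lies in the ball of radius `C * R`, where the next one-step bound
    -- is needed.
    obtain ⟨C', hC', h'⟩ := exists_norm_feedbackMap_sub_le hG hi hp (C * R)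
    refine ⟨C' * C, one_le_mul_of_one_le_of_one_le hC' hC, fun P hP x hx hR k hk => ?_⟩
    have hC0 : 0 ≤ C := zero_le_one.trans hC
    have hC'0 : 0 ≤ C' := zero_le_one.trans hC'
    rcases Nat.le_succ_iff.1 hk with hk | rfl
    · refine (h P hP x hx hR k hk).trans ?_
      exact mul_le_mul_of_nonneg_right (le_mul_of_one_le_left hC0 hC') (norm_nonneg _)
    · have h1 := h P hP x hx hR T le_rfl
      rw [hx T, mul_assoc]
      exact (h' _ (hP T) _ (h1.trans (mul_le_mul_of_nonneg_left hR hC0))).trans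
        (mul_le_mul_of_nonneg_left h1 hC'0)

end Growth

/-! ### Uniform entrance time -/

section UniformEntrance

variable {n : ℕ} {G : EuclideanSpace ℝ (Fin n) → ℝ}

/-- The solution with a given switching sequence and initial state. -/
noncomputable def solution (G : EuclideanSpace ℝ (Fin n) → ℝ)
    (P : ℕ → Matrix (Fin n) (Fin n) ℝ) (x₀ : EuclideanSpace ℝ (Fin n)) :
    ℕ → EuclideanSpace ℝ (Fin n)
  | 0 => x₀
  | k + 1 => feedbackMap G (P k) (solution G P x₀ k)

theorem IsSolution.eq_solution {P : ℕ → Matrix (Fin n) (Fin n) ℝ}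
    {x : ℕ → EuclideanSpace ℝ (Fin n)} (hx : IsSolution G P x) (k : ℕ) :
    x k = solution G P (x 0) k := by
  induction k with
  | zero => rfl
  | succ k ih => rw [hx k, ih, solution]

/-- Joint continuity at a fixed time, with the product topology on sequences, makes entrance at that
time an open condition. -/
theorem continuous_solution (hG : Continuous G) (k : ℕ) :
    Continuous fun q : (ℕ → Matrix (Fin n) (Fin n) ℝ) × EuclideanSpace ℝ (Fin n) =>
      solution G q.1 q.2 k := by
  induction k with
  | zero => exact continuous_snd
  | succ k ih =>
    have h1 : Continuous fun q : (ℕ → Matrix (Fin n) (Fin n) ℝ) × EuclideanSpace ℝ (Fin n) =>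
      (q.1 k).mulVec (solution G q.1 q.2 k).ofLp :=
      ((continuous_apply k).comp continuous_fst).matrix_mulVec
        ((PiLp.continuous_ofLp 2 _).comp ih)
    exact ((PiLp.continuous_toLp 2 _).comp h1).add ((hG.comp ih).smul continuous_const)

/-- Solutions from a ball come close to the equilibrium within a uniform time. -/
theorem exists_uniform_time {S : Set (Matrix (Fin n) (Fin n) ℝ)} (hS : IsCompact S)
    (hstoch : S ⊆ (Matrix.rowStochastic ℝ (Fin n) : Set (Matrix (Fin n) (Fin n) ℝ)))
    (herg : UniformlyErgodic S) (hG : Continuous G) (hi : LipschitzNearConsensus G)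
    (hii : DecreasingAtInfinity (scalarMap G)) {p : ℝ}
    (hp : ∀ y, Tendsto (fun k : ℕ => (scalarMap G)^[k] y) atTop (𝓝 p)) (i : Fin n) {K ρ : ℝ}
    (hρ : 0 < ρ) (R : ℝ) :
    ∃ T, ∀ P : ℕ → Matrix (Fin n) (Fin n) ℝ, (∀ k, P k ∈ S) → ∀ x, IsSolution G P x →
      ‖x 0 - p • ones n‖ ≤ R → ∃ k ≤ T, |x k i - p| + K * spread (x k) < ρ := by
  obtain ⟨T, hT⟩ := ((isCompact_sequences hS).prod
    (isCompact_closedBall (p • ones n) R)).exists_bound_of_iUnion_nat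
    (U := fun k => {q | |solution G q.1 q.2 k i - p| + K * spread (solution G q.1 q.2 k) < ρ})
    (fun k => by
      have h := continuous_solution hG k
      have hi : Continuous fun q : (ℕ → Matrix (Fin n) (Fin n) ℝ) × EuclideanSpace ℝ (Fin n) =>
        solution G q.1 q.2 k i := by fun_prop
      exact isOpen_lt ((hi.sub continuous_const).abs.add
        (continuous_const.mul (continuous_spread.comp h))) continuous_const)
    (fun q hq => exists_near (fun k => hstoch (hq.1 k)) (herg q.1 hq.1).1 hi hii hG hp
      (fun _ => rfl) i hρ)
  refine ⟨T, fun P hP x hx hR => ?_⟩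
  obtain ⟨k, hk, h⟩ := hT (P, x 0) ⟨hP, mem_closedBall_iff_norm.2 hR⟩
  refine ⟨k, hk, ?_⟩
  rw [hx.eq_solution k]
  exact h

end UniformEntrance

/-! ### Assembly of the exponential estimate -/

theorem globallyUniformlyExponentiallyStable_feedbackMap {n : ℕ}
    {S : Set (Matrix (Fin n) (Fin n) ℝ)} (hS : IsCompact S)
    (hstoch : S ⊆ (Matrix.rowStochastic ℝ (Fin n) : Set (Matrix (Fin n) (Fin n) ℝ)))
    (herg : UniformlyErgodic S) {G : EuclideanSpace ℝ (Fin n) → ℝ} (hG : Continuous G)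
    (hi : LipschitzNearConsensus G) (hii : DecreasingAtInfinity (scalarMap G)) {p : ℝ}
    (hp : ∀ y, Tendsto (fun k : ℕ => (scalarMap G)^[k] y) atTop (𝓝 p))
    (hexp : LocallyExponentiallyStable (scalarMap G) p) :
    GloballyUniformlyExponentiallyStable (feedbackMap G) S (p • ones n) := by
  refine ⟨fun P hP => feedbackMap_fixed hexp.1 (hstoch hP), ?_⟩
  -- For `n = 0` there is no coordinate to follow, but the space is a point.
  rcases isEmpty_or_nonempty (Fin n) with hn | ⟨⟨i⟩⟩
  · refine ⟨1 / 2, by norm_num, by norm_num, fun R _ => ⟨1, le_rfl, fun s _ k₀ x _ _ k _ => ?_⟩⟩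
    rw [Subsingleton.elim (x k) (p • ones n), sub_self, norm_zero]
    positivity
  obtain ⟨N, hN, K, hK, ρ, hρ, hcontr⟩ := exists_block_contraction hS hstoch herg hi hexp i
  have hW : ∀ P : ℕ → Matrix (Fin n) (Fin n) ℝ, (∀ k, P k ∈ S) →
      ∀ x, IsSolution G P x → |x 0 i - p| + K * spread (x 0) < ρ → ∀ j : ℕ,
        |x (N * j) i - p| + K * spread (x (N * j)) ≤
          (3 / 4) ^ j * (|x 0 i - p| + K * spread (x 0)) := by
    intro P hP x hx hx0 j
    have hW0 : 0 ≤ |x 0 i - p| + K * spread (x 0) :=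
      add_nonneg (abs_nonneg _) (mul_nonneg hK.le (spread_nonneg _))
    induction j with
    | zero => simp
    | succ j ih =>
      have hj : ((3 : ℝ) / 4) ^ j ≤ 1 := pow_le_one₀ (by norm_num) (by norm_num)
      have := hcontr _ (fun k => hP (N * j + k)) _ (hx.shift (N * j))
        ((ih.trans (mul_le_of_le_one_left hW0 hj)).trans_lt hx0)
      rw [Nat.mul_succ, pow_succ']
      simp only [add_zero] at this
      linarith
  -- The per-step rate whose `N`-th power is the block factor; it does not depend on `R`.
  set r : ℝ := (3 / 4) ^ (1 / (N : ℝ)) with hr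
  have hr0 : 0 < r := by positivity
  have hr1 : r < 1 := Real.rpow_lt_one (by norm_num) (by norm_num) (by positivity)
  have hrN : r ^ N = 3 / 4 := by
    rw [hr, one_div]
    exact Real.rpow_inv_natCast_pow (by norm_num) hN.ne'
  refine ⟨r, hr0, hr1, fun R hR => ?_⟩
  obtain ⟨T, hT⟩ := exists_uniform_time hS hstoch herg hG hi hii hp i (K := K) hρ R
  obtain ⟨C₁, hC₁, h₁⟩ := exists_norm_solution_sub_le hG hi hexp.1 R T
  -- This radius covers all states with weighted sum below `ρ`; `C₂` serves the last, incomplete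
  -- block.
  obtain ⟨C₂, hC₂, h₂⟩ := exists_norm_solution_sub_le hG hi hexp.1
    (n * (1 + 1 / K) * ρ) N
  -- Near the equilibrium, the norm and the weighted sum are equivalent.
  have hup : ∀ x : EuclideanSpace ℝ (Fin n),
      ‖x - p • ones n‖ ≤ n * (1 + 1 / K) * (|x i - p| + K * spread x) := fun x => by
    refine (norm_sub_smul_ones_le_add x p i).trans ?_
    rw [mul_assoc]
    refine mul_le_mul_of_nonneg_left ?_ n.cast_nonneg
    have h1 : 0 ≤ 1 / K * |x i - p| := by positivity
    have h2 : 0 ≤ K * spread x := mul_nonneg hK.le (spread_nonneg x)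
    have h3 : 1 / K * (K * spread x) = spread x := by field_simp
    linarith
  have hlow : ∀ x : EuclideanSpace ℝ (Fin n),
      |x i - p| + K * spread x ≤ (1 + 2 * K) * ‖x - p • ones n‖ := fun x => by
    have h1 := abs_apply_sub_le_norm x p i
    have h2 := mul_le_mul_of_nonneg_left (spread_le_two_mul_norm_sub x p) hK.le
    linarith
  set A : ℝ := n * (1 + 1 / K) with hA
  have hA0 : 0 ≤ A := by positivity
  have hC₁0 : 0 < C₁ := zero_lt_one.trans_le hC₁
  have hC₂0 : 0 < C₂ := zero_lt_one.trans_le hC₂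
  set Q : ℝ := C₂ * (1 + A * (1 + 2 * K)) * C₁ with hQ
  have hAK : 0 ≤ A * (1 + 2 * K) := by positivity
  have hC₁Q : C₁ ≤ Q := by
    refine le_mul_of_one_le_left hC₁0.le (one_le_mul_of_one_le_of_one_le hC₂ ?_)
    linarith
  have hinv : ∀ m, 1 ≤ r⁻¹ ^ m := fun m => one_le_pow₀ ((one_le_inv₀ hr0).2 hr1.le)
  -- The power of `r⁻¹` pays for steps without guaranteed decay: up to `T` before entrance and fewer
  -- than `N` in the last block.
  refine ⟨Q * r⁻¹ ^ (T + N), one_le_mul_of_one_le_of_one_le (hC₁.trans hC₁Q) (hinv _),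
    fun P hP k₀ z hz hzR => ?_⟩
  suffices H : ∀ P : ℕ → Matrix (Fin n) (Fin n) ℝ, (∀ k, P k ∈ S) →
      ∀ x, IsSolution G P x → ‖x 0 - p • ones n‖ ≤ R → ∀ k,
        ‖x k - p • ones n‖ ≤ Q * r⁻¹ ^ (T + N) * r ^ k * ‖x 0 - p • ones n‖ by
    intro k hk
    have := H _ (fun k => hP (k₀ + k)) (fun k => z (k₀ + k))
      (fun k => hz (k₀ + k) (Nat.le_add_right _ _)) hzR (k - k₀)
    simpa [Nat.add_sub_cancel' hk] using this
  clear hzR hz z k₀ hP P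
  intro P hP x hx hR k
  have hpow : ∀ a m, a ≤ T + N → r ^ m ≤ r⁻¹ ^ (T + N) * r ^ (m + a) := fun a m ha => by
    have h1 : r⁻¹ ^ (T + N) * r ^ (m + a) = r ^ m * r⁻¹ ^ (T + N - a) := by
      rw [← Nat.sub_add_cancel ha, Nat.add_sub_cancel, pow_add, pow_add]
      have : r⁻¹ ^ a * r ^ a = 1 := by rw [← mul_pow, inv_mul_cancel₀ hr0.ne', one_pow]
      linear_combination r⁻¹ ^ (T + N - a) * r ^ m * this
    rw [h1]
    exact le_mul_of_one_le_right (by positivity) (hinv _)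
  obtain ⟨t, htT, ht⟩ := hT P hP x hx hR
  have hgrow := h₁ P (fun k => hstoch (hP k)) x hx hR
  have hx0 := norm_nonneg (x 0 - p • ones n)
  rcases le_total k t with hkt | hkt
  · refine (hgrow k (hkt.trans htT)).trans (mul_le_mul_of_nonneg_right ?_ hx0)
    have h1 : 1 ≤ r⁻¹ ^ (T + N) * r ^ k := by
      simpa using hpow k 0 (by omega)
    rw [mul_assoc]
    exact hC₁Q.trans (le_mul_of_one_le_right (hC₁0.le.trans hC₁Q) h1)
  -- The elapsed time splits into entrance time `t`, `j` full blocks and a remainder `m < N`.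
  · obtain ⟨l, rfl⟩ := Nat.exists_eq_add_of_le hkt
    have hmod := Nat.mod_lt l hN
    set j := l / N with hj
    set m := l % N with hm
    have hl : l = N * j + m := (Nat.div_add_mod l N).symm
    have hdec := hW _ (fun k => hP (t + k)) _ (hx.shift t) ht j
    simp only [add_zero] at hdec
    have hWt : 0 ≤ |x t i - p| + K * spread (x t) :=
      add_nonneg (abs_nonneg _) (mul_nonneg hK.le (spread_nonneg _))
    have hj1 : ((3 : ℝ) / 4) ^ j ≤ 1 := pow_le_one₀ (by norm_num) (by norm_num)
    have hball : ‖x (t + N * j) - p • ones n‖ ≤ A * ρ :=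
      (hup _).trans (mul_le_mul_of_nonneg_left
        ((hdec.trans (mul_le_of_le_one_left hWt hj1)).trans ht.le) hA0)
    have hlast := h₂ _ (fun k => hstoch (hP (t + N * j + k))) _ (hx.shift (t + N * j)) hball m
      hmod.le
    rw [hl, ← add_assoc]
    have hrj : ((3 : ℝ) / 4) ^ j ≤ r⁻¹ ^ (T + N) * r ^ (t + N * j + m) := by
      have := hpow (t + m) (N * j) (by omega)
      rw [pow_mul, hrN] at this
      rwa [show t + N * j + m = N * j + (t + m) by ring]
    calc ‖x (t + N * j + m) - p • ones n‖
        ≤ C₂ * ‖x (t + N * j) - p • ones n‖ := hlast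
      _ ≤ C₂ * (A * ((3 / 4) ^ j * ((1 + 2 * K) * (C₁ * ‖x 0 - p • ones n‖)))) := by
          have h3 := (hlow (x t)).trans
            (mul_le_mul_of_nonneg_left (hgrow t htT) (by positivity))
          have h4 := (hup (x (t + N * j))).trans (mul_le_mul_of_nonneg_left
            (hdec.trans (mul_le_mul_of_nonneg_left h3 (by positivity))) hA0)
          exact mul_le_mul_of_nonneg_left h4 hC₂0.le
      _ = C₂ * (A * (1 + 2 * K)) * C₁ * (3 / 4) ^ j * ‖x 0 - p • ones n‖ := by ring
      _ ≤ Q * (r⁻¹ ^ (T + N) * r ^ (t + N * j + m)) * ‖x 0 - p • ones n‖ := by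
          refine mul_le_mul_of_nonneg_right (mul_le_mul ?_ hrj (by positivity)
            (hC₁0.le.trans hC₁Q)) hx0
          exact mul_le_mul_of_nonneg_right
            (mul_le_mul_of_nonneg_left (by linarith) hC₂0.le) hC₁0.le
      _ = _ := by ring

end ConsensusFeedback

theorem corollary1 (n : ℕ) (S : Set (Matrix (Fin n) (Fin n) ℝ))
    (hS : IsCompact S)
    (hstoch : S ⊆ (Matrix.rowStochastic ℝ (Fin n) : Set (Matrix (Fin n) (Fin n) ℝ)))
    (herg : ConsensusFeedback.UniformlyErgodic S)
    (G : EuclideanSpace ℝ (Fin n) → ℝ) (hG : Differentiable ℝ G)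
    (hi : ConsensusFeedback.LipschitzNearConsensus G)
    (hii : ConsensusFeedback.DecreasingAtInfinity (ConsensusFeedback.scalarMap G))
    (ystar : ℝ)
    (hglob : ConsensusFeedback.GloballyAsymptoticallyStable
      (ConsensusFeedback.scalarMap G) ystar)
    (hexp : ConsensusFeedback.LocallyExponentiallyStable
      (ConsensusFeedback.scalarMap G) ystar) :
    ConsensusFeedback.GloballyUniformlyExponentiallyStable
      (ConsensusFeedback.feedbackMap G) S (ystar • ConsensusFeedback.ones n) :=
  ConsensusFeedback.globallyUniformlyExponentiallyStable_feedbackMap hS hstoch herg hG.continuous hi hii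
    hglob.2.2 hexp
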